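/- Let $m\ge 1$ be an integer and $n=m^2$, and let $s_1,\dots,s_n$ be independent random variables, each uniformly distributed on $\{1,\dots,n\}$. Algorithm BUCKET uses $m$ initially empty buckets $B_1,\dots,B_m$ and processes $s_1,s_2,\dots,s_n$ in this order: with $r=\lceil s_i/m\rceil$, it searches for $s_i$ among the elements of $B_r$; if $s_i$ is found there (the first repetition), the algorithm stops, otherwise $s_i$ is put into $B_r$; the algorithm also stops after $s_n$ has been processed. Let $b_j$ be the number of elements in $B_j$ when the algorithm stops (at the moment of the first repetition, if there is one). Then $$\mathrm{E}\{b_j\}=\sqrt{\frac{\pi}{2}}-\mu(n)\qquad\text{for } j=1,2,\dots,m,$$ where, for every positive integer $n$, $$\mu(n)=\frac{1}{3\sqrt n}-\frac{\kappa(n)}{\sqrt n},\qquad \kappa(n)=\frac13-\sqrt{\frac{\pi n}{2}}+\sum_{k=1}^{n}\frac{n!\,k^2}{(n-k)!\,n^{k+1}}.$$ Moreover $\mu(n)$, as a function of the positive integer $n$, is strictly decreasing and tends to $0$ as $n\to\infty$. -/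

import Mathlib

namespace BucketTest

/-- The index `⌈x / m⌉` of the bucket to which the number `x` belongs. -/
def bucketIndex (m x : ℕ) : ℕ := ⌈(x : ℚ) / m⌉₊

/-- The main loop of the algorithm `BUCKET` with bucket size `m`, started with bucket contents `B`:
each input element is looked up in its own bucket `B r`; if it is found there (the first
repetition), the algorithm stops at once, otherwise the element is put at the end of that bucket.
The loop also stops when the input is exhausted. The value is the family of bucket contents at
the moment of stopping. -/
def bucketLoop (m : ℕ) : List ℕ → (ℕ → List ℕ) → (ℕ → List ℕ)
  | [], B => B
  | x :: xs, B =>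
      if x ∈ B (bucketIndex m x) then B
      else bucketLoop m xs
        (Function.update B (bucketIndex m x) (B (bucketIndex m x) ++ [x]))

/-- The number of elements in the bucket `j` when `BUCKET`, started with empty buckets on the
input `s` of length `n`, stops. -/
def bucketCount (m : ℕ) {n : ℕ} (s : Fin n → ℕ) (j : ℕ) : ℕ :=
  (bucketLoop m (List.ofFn s) (fun _ => []) j).length

/-- `κ(n) = 1/3 - √(π n / 2) + ∑_{k=1}^n n! k² / ((n - k)! n^(k+1))`. -/
noncomputable def kappa (n : ℕ) : ℝ :=
  1 / 3 - Real.sqrt (Real.pi * n / 2) +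
    ∑ k ∈ Finset.Icc 1 n,
      ((n.factorial : ℝ) * (k : ℝ) ^ 2) / (((n - k).factorial : ℝ) * (n : ℝ) ^ (k + 1))

/-- `μ(n) = 1 / (3 √n) - κ(n) / √n`. -/
noncomputable def mu (n : ℕ) : ℝ :=
  1 / (3 * Real.sqrt n) - kappa n / Real.sqrt n

end BucketTest

/-! Equal numbers share a bucket, so the search detects every repetition. Hence `b_j` is the sum
over `i` of the indicators that `s_1, ..., s_i` are distinct and `s_i` belongs to bucket `j`. By
symmetry such an event has probability `(m/n) · n!/((n-i)! n^i)`, so the mean is `Q(n)/√n` with `Q`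
Ramanujan's function; Abel summation identifies `Q(n)` with the sum in `κ`.

For `μ`, write `Q(n) = n ∫ (1+x)^(n-1) e^(-nx) dx` over `x > 0`. Substituting `t²/2 = x - log(1+x)`
and then `s = √n t` gives `Q(n)/√n = ∫ e^(-s²/2) ρ(s/√n) ds`, where `ρ(t) = t/x` is strictly
decreasing and `1 - t ≤ ρ(t) ≤ 1`. Thus `μ(n) = ∫ e^(-s²/2) (1 - ρ(s/√n)) ds` strictly decreases,
and it is `O(1/√n)`. The main steps are `integrable_integral_bucketCount`, `strictAntiOn_saddle_div`
and `ramanujanQ_div_sqrt`. -/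

namespace BucketTest

/-! ### Ramanujan's function and the sum in `κ` -/

open MeasureTheory ProbabilityTheory

/-- The Ramanujan function `Q(n) = ∑_{k=1}^n n! / ((n - k)! n^k)`. -/
noncomputable def ramanujanQ (n : ℕ) : ℝ :=
  ∑ k ∈ Finset.range n, (n.descFactorial (k + 1) : ℝ) / (n : ℝ) ^ (k + 1)

/-- Abel summation: with `p k = n!/((n-k)! n^k)` one has `k p k / n = p k - p (k+1)`, and the
boundary term vanishes because `p (n+1) = 0`. -/
lemma sum_sq_eq_ramanujanQ {n : ℕ} (hn : n ≠ 0) :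
    ∑ k ∈ Finset.Icc 1 n,
      ((n.factorial : ℝ) * (k : ℝ) ^ 2) / (((n - k).factorial : ℝ) * (n : ℝ) ^ (k + 1))
      = ramanujanQ n := by
  have hn' : (n : ℝ) ≠ 0 := by exact_mod_cast hn
  set p : ℕ → ℝ := fun k => (n.descFactorial k : ℝ) / (n : ℝ) ^ k with hp
  have hstep (k : ℕ) (hk : k ≤ n) : (k : ℝ) * p k / n = p k - p (k + 1) := by
    simp only [hp, Nat.descFactorial_succ, Nat.cast_mul, Nat.cast_sub hk]
    field_simp
    ring
  have htel (N : ℕ) : ∑ k ∈ Finset.Icc 1 N, (k : ℝ) * (p k - p (k + 1))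
      = ∑ k ∈ Finset.range N, p (k + 1) - N * p (N + 1) := by
    induction N with
    | zero => simp
    | succ N ih =>
      rw [Finset.sum_Icc_succ_top (by omega), ih, Finset.sum_range_succ]
      push_cast
      ring
  have hlast : p (n + 1) = 0 := by simp [hp]
  have := htel n
  rw [hlast, mul_zero, sub_zero] at this
  rw [ramanujanQ, ← this]
  refine Finset.sum_congr rfl fun k hk => ?_
  obtain ⟨_, hk⟩ := Finset.mem_Icc.1 hk
  rw [← hstep k hk]
  simp only [hp, ← Nat.factorial_mul_descFactorial hk]
  have : ((n - k).factorial : ℝ) ≠ 0 := by exact_mod_cast (n - k).factorial_ne_zero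
  push_cast
  field_simp
  ring

lemma sqrt_pi_div_two_sub_mu {n : ℕ} (hn : n ≠ 0) :
    Real.sqrt (Real.pi / 2) - mu n = ramanujanQ n / Real.sqrt n := by
  have hn' : 0 < Real.sqrt n := Real.sqrt_pos.2 (by positivity)
  rw [mu, kappa, sum_sq_eq_ramanujanQ hn,
    show Real.pi * n / 2 = Real.pi / 2 * n by ring, Real.sqrt_mul (by positivity)]
  field_simp
  ring

/-! ### Bucket contents as sums of indicators -/

open Classical in
-- Arbitrary initial buckets `B` make the induction on the input possible. The default value in
-- `getD` is never read, since `i < L.length`.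
lemma length_bucketLoop (m j : ℕ) (L : List ℕ) (B : ℕ → List ℕ) :
    (bucketLoop m L B j).length = (B j).length + ∑ i ∈ Finset.range L.length,
      if (L.take (i + 1)).Nodup ∧ (∀ x ∈ L.take (i + 1), x ∉ B (bucketIndex m x)) ∧
        bucketIndex m (L.getD i 0) = j then 1 else 0 := by
  induction L generalizing B with
  | nil => simp [bucketLoop]
  | cons x xs ih =>
    rw [bucketLoop]
    split_ifs with hx
    · simp [hx]
    · rw [ih, List.length_cons, Finset.sum_range_succ']
      have h0 : (Function.update B (bucketIndex m x) (B (bucketIndex m x) ++ [x]) j).length =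
          (B j).length + if bucketIndex m x = j then 1 else 0 := by
        by_cases h : bucketIndex m x = j
        · subst h; simp
        · simp [h, Function.update_of_ne (Ne.symm h)]
      -- Searching one bucket suffices: a number with another bucket index cannot equal `x`.
      have hB (y : ℕ) : y ∉ Function.update B (bucketIndex m x)
          (B (bucketIndex m x) ++ [x]) (bucketIndex m y) ↔ y ∉ B (bucketIndex m y) ∧ y ≠ x := by
        by_cases h : bucketIndex m y = bucketIndex m x
        · rw [h]; simp
        · rw [Function.update_of_ne h]
          have : y ≠ x := fun e => h (e ▸ rfl)
          simp [this]
      rw [h0, add_assoc]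
      congr 1
      rw [add_comm]
      congr 1
      · refine Finset.sum_congr rfl fun i _ => ?_
        simp only [hB, List.take_succ_cons, List.nodup_cons, List.mem_cons, forall_eq_or_imp,
          List.getD_cons_succ]
        congr 1
        apply propext
        constructor
        · rintro ⟨h1, h2, h3⟩
          exact ⟨⟨fun h => (h2 x h).2 rfl, h1⟩, ⟨hx, fun y hy => (h2 y hy).1⟩, h3⟩
        · rintro ⟨⟨h1, h2⟩, ⟨h3, h4⟩, h5⟩
          exact ⟨h2, fun y hy => ⟨h4 y hy, fun e => h1 (e ▸ hy)⟩, h5⟩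
      · simp [hx]

open Classical in
lemma bucketCount_eq_sum (m j : ℕ) {n : ℕ} (s : Fin n → ℕ) :
    bucketCount m s j = ∑ i : Fin n,
      if Function.Injective (fun l : Fin (i + 1) => s (Fin.castLE i.2 l)) ∧
        bucketIndex m (s i) = j then 1 else 0 := by
  rw [bucketCount, length_bucketLoop, List.length_ofFn, ← Fin.sum_univ_eq_sum_range
    (fun i => if ((List.ofFn s).take (i + 1)).Nodup ∧
      (∀ x ∈ (List.ofFn s).take (i + 1), x ∉ (fun _ => [] : ℕ → List ℕ) (bucketIndex m x)) ∧
        bucketIndex m ((List.ofFn s).getD i 0) = j then 1 else 0) n]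
  simp only [List.length_nil, zero_add, List.not_mem_nil, not_false_eq_true, implies_true,
    true_and]
  refine Finset.sum_congr rfl fun i _ => ?_
  have h1 : (List.ofFn s).take (i + 1) =
      List.ofFn (fun l : Fin (i + 1) => s (Fin.castLE i.2 l)) := by
    apply List.ext_getElem
    · simp
    · intro k h1 h2
      rw [List.getElem_take, List.getElem_ofFn, List.getElem_ofFn]
      rfl
  have h2 : (List.ofFn s).getD i 0 = s i := by
    rw [List.getD_eq_getElem _ _ (by simp)]
    simp
  simp only [h1, h2, List.nodup_ofFn]

/-! ### Counting and expectation -/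

/-- Independent variables that are uniform on a finite set are jointly uniform on its power. -/
lemma measureReal_of_uniform_iIndep {Ω α : Type*} [MeasurableSpace Ω] {P : Measure Ω}
    [IsProbabilityMeasure P] [MeasurableSpace α] [Countable α] [MeasurableSingletonClass α]
    {ι : Type*} [Fintype ι] [DecidableEq ι] {S : Finset α} {X : ι → Ω → α}
    (hX : ∀ i, HasLaw (X i) (uniformOn (S : Set α)) P) (hi : iIndepFun X P)
    (p : (ι → α) → Prop) [DecidablePred p] :
    P.real {ω | p (fun i => X i ω)} =
      ((Fintype.piFinset fun _ : ι => S).filter p).card / (S.card : ℝ) ^ Fintype.card ι := by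
  classical
  have hpi : Measure.pi (fun _ : ι => uniformOn (S : Set α)) =
      uniformOn ((Fintype.piFinset fun _ : ι => S : Finset (ι → α)) : Set (ι → α)) := by
    refine Measure.ext_of_singleton fun f => ?_
    rw [Measure.pi_singleton, ← Finset.coe_singleton f, uniformOn_apply_finset]
    simp only [← Finset.coe_singleton, uniformOn_apply_finset]
    rw [ENNReal.prod_div_distrib_of_ne_top (by simp)]
    congr 1
    · by_cases h : f ∈ Fintype.piFinset fun _ : ι => S
      · rw [Finset.inter_singleton_of_mem h]
        rw [Fintype.mem_piFinset] at h
        simp [h]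
      · rw [Finset.inter_singleton_of_notMem h]
        rw [Fintype.mem_piFinset, not_forall] at h
        obtain ⟨i, hi⟩ := h
        rw [Finset.prod_eq_zero (Finset.mem_univ i)]
        · simp
        · simp [hi]
    · simp
  have hlaw := hi.hasLaw_pi hX
  rw [hpi] at hlaw
  rw [hlaw.measureReal_eq (p := p) (Set.to_countable _).measurableSet, measureReal_def,
    ← uniformOn_inter_self (Finset.finite_toSet _)]
  have : ((Fintype.piFinset fun _ : ι => S : Finset (ι → α)) : Set (ι → α)) ∩ {f | p f} =
      (((Fintype.piFinset fun _ : ι => S).filter p : Finset (ι → α)) : Set (ι → α)) := by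
    ext; simp
  rw [this, uniformOn_apply_finset, Finset.inter_eq_right.2 (Finset.filter_subset _ _)]
  simp

lemma card_piFinset_filter_injective {α : Type*} [DecidableEq α] (S : Finset α) (k : ℕ) :
    ((Fintype.piFinset fun _ : Fin k => S).filter Function.Injective).card =
      S.card.descFactorial k := by
  rw [← Fintype.card_coe S]
  conv_rhs => rw [← Fintype.card_fin k]
  rw [← Fintype.card_embedding_eq, ← Finset.card_univ]
  symm
  refine Finset.card_bij (fun (e : Fin k ↪ S) _ => fun i => (e i : α)) ?_ ?_ ?_
  · intro e _
    simp only [Finset.mem_filter, Fintype.mem_piFinset, Finset.coe_mem, implies_true, true_and]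
    exact Subtype.val_injective.comp e.injective
  · intro e _ e' _ h
    ext i
    exact congrFun h i
  · intro f hf
    simp only [Finset.mem_filter, Fintype.mem_piFinset] at hf
    exact ⟨⟨fun i => ⟨f i, hf.1 i⟩, fun a b h => hf.2 (congrArg Subtype.val h)⟩,
      Finset.mem_univ _, rfl⟩

/-- Composing with the transposition of `y` and `z` injects the fibre over `y` into that over `z`,
so all `S.card` fibres of `f ↦ f l` have equal size. -/
lemma card_mul_card_piFinset_filter_injective_eq {α : Type*} [DecidableEq α] (S : Finset α)
    {k : ℕ} (l : Fin k) {x : α} (hx : x ∈ S) :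
    S.card * ((Fintype.piFinset fun _ : Fin k => S).filter
      fun f => Function.Injective f ∧ f l = x).card = S.card.descFactorial k := by
  set N : α → ℕ := fun y => ((Fintype.piFinset fun _ : Fin k => S).filter
      fun f => Function.Injective f ∧ f l = y).card
  have hle (y z : α) (hy : y ∈ S) (hz : z ∈ S) : N y ≤ N z := by
    refine Finset.card_le_card_of_injOn (fun f => Equiv.swap y z ∘ f) ?_ ?_
    · intro f hf
      simp only [Finset.coe_filter, Set.mem_ofPred_eq, Fintype.mem_piFinset,
        Function.comp_apply] at hf ⊢
      refine ⟨fun a => ?_, (Equiv.injective _).comp hf.2.1, by rw [hf.2.2, Equiv.swap_apply_left]⟩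
      rw [Equiv.swap_apply_def]
      split_ifs
      exacts [hz, hy, hf.1 a]
    · intro f _ g _ h
      exact (Equiv.injective (Equiv.swap y z)).comp_left h
  rw [← card_piFinset_filter_injective, Finset.card_eq_sum_card_fiberwise
    (f := fun f : Fin k → α => f l) (s := Finset.filter Function.Injective _) (t := S)]
  · rw [Finset.sum_congr rfl (g := fun _ => N x), Finset.sum_const, smul_eq_mul]
    intro y hy
    rw [Finset.filter_filter]
    exact le_antisymm (hle y x hy hx) (hle x y hx hy)
  · intro f hf
    simp only [Finset.coe_filter, Set.mem_ofPred_eq, Fintype.mem_piFinset] at hf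
    exact hf.1 l

lemma bucketIndex_eq_iff {m x j : ℕ} (hm : 1 ≤ m) (hj : 1 ≤ j) :
    bucketIndex m x = j ↔ x ∈ Finset.Ioc ((j - 1) * m) (j * m) := by
  have hm' : (0 : ℚ) < m := by exact_mod_cast hm
  rw [bucketIndex, Nat.ceil_eq_iff (by omega), lt_div_iff₀ hm', div_le_iff₀ hm', Finset.mem_Ioc]
  norm_cast

lemma card_filter_bucketIndex {m j : ℕ} (hm : 1 ≤ m) (hj : j ∈ Finset.Icc 1 m) :
    ((Finset.Icc 1 (m ^ 2)).filter fun x => bucketIndex m x = j).card = m := by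
  obtain ⟨hj1, hjm⟩ := Finset.mem_Icc.1 hj
  have : ((Finset.Icc 1 (m ^ 2)).filter fun x => bucketIndex m x = j) =
      Finset.Ioc ((j - 1) * m) (j * m) := by
    ext x
    rw [Finset.mem_filter, bucketIndex_eq_iff hm hj1, Finset.mem_Icc, Finset.mem_Ioc]
    refine ⟨fun h => h.2, fun h => ⟨⟨by omega, h.2.trans ?_⟩, h⟩⟩
    rw [sq]
    exact Nat.mul_le_mul_right m hjm
  obtain ⟨i, rfl⟩ : ∃ i, j = i + 1 := ⟨j - 1, by omega⟩
  rw [this, Nat.card_Ioc, Nat.add_sub_cancel, Nat.add_mul]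
  omega

lemma measureReal_injective_and_bucketIndex_eq {Ω : Type*} [MeasurableSpace Ω] {P : Measure Ω}
    [IsProbabilityMeasure P] {m n k j : ℕ} (hm : 1 ≤ m) (hn : n = m ^ 2)
    {X : Fin k → Ω → ℕ} (hX : ∀ i, HasLaw (X i) (uniformOn (Set.Icc 1 n)) P)
    (hi : iIndepFun X P) (hj : j ∈ Finset.Icc 1 m) (l : Fin k) :
    P.real {ω | Function.Injective (fun i => X i ω) ∧ bucketIndex m (X l ω) = j} =
      m / n * (n.descFactorial k / (n : ℝ) ^ k) := by
  classical
  have hn0 : (n : ℝ) ≠ 0 := by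
    have : 0 < m ^ 2 := by positivity
    exact_mod_cast (by omega : n ≠ 0)
  rw [← Finset.coe_Icc] at hX
  have key := measureReal_of_uniform_iIndep hX hi
    (fun f => Function.Injective f ∧ bucketIndex m (f l) = j)
  rw [key, Nat.card_Icc, Fintype.card_fin, Nat.add_sub_cancel]
  have hc : n * ((Fintype.piFinset fun _ : Fin k => Finset.Icc 1 n).filter
      fun f => Function.Injective f ∧ bucketIndex m (f l) = j).card = m * n.descFactorial k := by
    rw [Finset.card_eq_sum_card_fiberwise (f := fun f => f l)
      (t := (Finset.Icc 1 n).filter fun x => bucketIndex m x = j), Finset.mul_sum,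
      Finset.sum_congr rfl (g := fun _ => n.descFactorial k), Finset.sum_const, smul_eq_mul,
      hn, card_filter_bucketIndex hm hj]
    · intro x hx
      rw [Finset.mem_filter] at hx
      have := card_mul_card_piFinset_filter_injective_eq (Finset.Icc 1 n) l hx.1
      rw [Nat.card_Icc, Nat.add_sub_cancel] at this
      rw [← this, Finset.filter_filter]
      congr 3
      ext f
      constructor
      · rintro ⟨⟨h1, _⟩, h2⟩
        exact ⟨h1, h2⟩
      · rintro ⟨h1, h2⟩
        exact ⟨⟨h1, h2 ▸ hx.2⟩, h2⟩
    · intro f hf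
      simp only [Finset.coe_filter, Set.mem_ofPred_eq, Fintype.mem_piFinset] at hf ⊢
      exact ⟨hf.1 l, hf.2.2⟩
  have hc' := congrArg (Nat.cast : ℕ → ℝ) hc
  push_cast at hc'
  field_simp
  linear_combination hc'

lemma integrable_integral_bucketCount {Ω : Type*} [MeasurableSpace Ω] (P : Measure Ω)
    [IsProbabilityMeasure P] {m n j : ℕ} (hm : 1 ≤ m) (hn : n = m ^ 2)
    (s : Fin n → Ω → ℕ) (hs : ∀ i, HasLaw (s i) (uniformOn (Set.Icc 1 n)) P)
    (hi : iIndepFun s P) (hj : j ∈ Finset.Icc 1 m) :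
    Integrable (fun ω => (bucketCount m (fun i => s i ω) j : ℝ)) P ∧
      ∫ ω, (bucketCount m (fun i => s i ω) j : ℝ) ∂P = m / n * ramanujanQ n := by
  classical
  set A : Fin n → Set Ω := fun i =>
    {ω | Function.Injective (fun l : Fin (i + 1) => s (Fin.castLE i.2 l) ω) ∧
        bucketIndex m (s i ω) = j} with hA
  have hvec : AEMeasurable (fun ω i => s i ω) P := aemeasurable_pi_lambda _ fun i => (hs i).aemeasurable
  -- `HasLaw` yields only a.e. measurability, hence null-measurable events.
  have hmeas (i : Fin n) : NullMeasurableSet (A i) P :=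
    hvec.nullMeasurableSet_preimage (s := {f : Fin n → ℕ |
      Function.Injective (fun l : Fin (i + 1) => f (Fin.castLE i.2 l)) ∧
        bucketIndex m (f i) = j}) (Set.to_countable _).measurableSet
  have heq : (fun ω => (bucketCount m (fun i => s i ω) j : ℝ)) =
      fun ω => ∑ i, (A i).indicator (fun _ => (1 : ℝ)) ω := by
    ext ω
    rw [bucketCount_eq_sum]
    push_cast
    simp only [Set.indicator_apply, hA, Set.mem_ofPred_eq]
  have hint (i : Fin n) : Integrable ((A i).indicator (fun _ => (1 : ℝ))) P :=
    (integrable_const 1).indicator₀ (hmeas i)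
  rw [heq]
  refine ⟨integrable_finsetSum _ fun i _ => hint i, ?_⟩
  rw [integral_finsetSum _ fun i _ => hint i, ramanujanQ, Finset.mul_sum, ← Fin.sum_univ_eq_sum_range
    (fun k => (m : ℝ) / n * ((n.descFactorial (k + 1) : ℝ) / (n : ℝ) ^ (k + 1))) n]
  refine Finset.sum_congr rfl fun i _ => ?_
  rw [integral_indicator₀ (hmeas i), setIntegral_const, smul_eq_mul, mul_one]
  exact measureReal_injective_and_bucketIndex_eq hm hn (fun l => hs (Fin.castLE i.2 l))
    (hi.precomp (Fin.castLE_injective i.2)) hj (Fin.last i)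

end BucketTest

/-! ### The saddle-point substitution -/

namespace BucketTest

open MeasureTheory Set

/-- The strictly increasing substitution `t = √(2 (x - log (1 + x)))` on the half-line. -/
noncomputable def saddle (x : ℝ) : ℝ := Real.sqrt (2 * (x - Real.log (1 + x)))

/-- The difference of the two sides vanishes at `0` and has derivative `x²/(1+x)²`. Positivity,
unboundedness and the decrease of `saddle x / x` all rest on this bound. -/
lemma sq_div_lt_saddle_sq {x : ℝ} (hx : 0 < x) :
    x ^ 2 / (1 + x) < 2 * (x - Real.log (1 + x)) := by
  have hmono : StrictMonoOn (fun y : ℝ => 2 * (y - Real.log (1 + y)) - y ^ 2 / (1 + y)) (Ici 0) := by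
    have hd (y : ℝ) (hy : 0 ≤ y) : HasDerivAt
        (fun y : ℝ => 2 * (y - Real.log (1 + y)) - y ^ 2 / (1 + y)) (y ^ 2 / (1 + y) ^ 2) y := by
      have h1 : (1 + y) ≠ 0 := by positivity
      have h2 := (hasDerivAt_id' y).const_add 1
      refine ((((hasDerivAt_id' y).fun_sub (h2.log h1)).const_mul 2).fun_sub
        (((hasDerivAt_id' y).fun_pow 2).fun_div h2 h1)).congr_deriv ?_
      field_simp
      ring
    refine strictMonoOn_of_deriv_pos (convex_Ici 0)
      (fun y hy => (hd y hy).continuousAt.continuousWithinAt) fun y hy => ?_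
    rw [interior_Ici, mem_Ioi] at hy
    rw [(hd y hy.le).deriv]
    positivity
  have := hmono self_mem_Ici (mem_Ici.2 hx.le) hx
  simp only [add_zero, Real.log_one, sub_zero, mul_zero] at this
  linarith

lemma saddle_arg_pos {x : ℝ} (hx : 0 < x) : 0 < 2 * (x - Real.log (1 + x)) :=
  (by positivity : 0 < x ^ 2 / (1 + x)).trans (sq_div_lt_saddle_sq hx)

lemma saddle_pos {x : ℝ} (hx : 0 < x) : 0 < saddle x := Real.sqrt_pos.2 (saddle_arg_pos hx)

lemma saddle_sq {x : ℝ} (hx : 0 < x) : saddle x ^ 2 = 2 * (x - Real.log (1 + x)) :=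
  Real.sq_sqrt (saddle_arg_pos hx).le

lemma hasDerivAt_saddle {x : ℝ} (hx : 0 < x) :
    HasDerivAt saddle (x / ((1 + x) * saddle x)) x := by
  have h1 : (1 + x) ≠ 0 := by positivity
  have h2 := (hasDerivAt_id' x).const_add 1
  refine ((((hasDerivAt_id' x).fun_sub (h2.log h1)).const_mul 2).sqrt
    (saddle_arg_pos hx).ne').congr_deriv ?_
  have := (saddle_pos hx).ne'
  change _ / (2 * saddle x) = x / ((1 + x) * saddle x)
  field_simp
  ring

lemma continuousOn_saddle : ContinuousOn saddle (Ici 0) := by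
  have : ContinuousOn (fun x : ℝ => Real.log (1 + x)) (Ici 0) :=
    ContinuousOn.log (by fun_prop) fun x hx => by
      have : (0 : ℝ) ≤ x := hx
      positivity
  unfold saddle
  fun_prop

lemma strictMonoOn_saddle : StrictMonoOn saddle (Ici 0) := by
  refine strictMonoOn_of_deriv_pos (convex_Ici 0) continuousOn_saddle fun x hx => ?_
  rw [interior_Ici, mem_Ioi] at hx
  rw [(hasDerivAt_saddle hx).deriv]
  have := saddle_pos hx
  positivity

lemma image_saddle : saddle '' Ioi 0 = Ioi 0 := by
  have h0 : saddle 0 = 0 := by simp [saddle]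
  have := continuousOn_saddle.image_Ioi_of_strictMonoOn strictMonoOn_saddle ?_
  · rwa [h0] at this
  · have h : Filter.Tendsto (fun x : ℝ => Real.sqrt (x - 1)) Filter.atTop Filter.atTop :=
      Real.tendsto_sqrt_atTop.comp (Filter.tendsto_atTop_add_const_right _ (-1) Filter.tendsto_id)
    refine Filter.tendsto_atTop_mono' _ ?_ h
    filter_upwards [Filter.eventually_gt_atTop 0] with x hx
    refine Real.sqrt_le_sqrt ?_
    have h1 := sq_div_lt_saddle_sq hx
    have h2 : x - 1 ≤ x ^ 2 / (1 + x) := by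
      rw [le_div_iff₀ (by positivity)]
      nlinarith
    linarith

lemma saddle_le {x : ℝ} (hx : 0 < x) : saddle x ≤ x := by
  have hanti : StrictMonoOn (fun y : ℝ => y ^ 2 - 2 * (y - Real.log (1 + y))) (Ici 0) := by
    have hd (y : ℝ) (hy : 0 ≤ y) : HasDerivAt
        (fun y : ℝ => y ^ 2 - 2 * (y - Real.log (1 + y))) (2 * y ^ 2 / (1 + y)) y := by
      have h1 : (1 + y) ≠ 0 := by positivity
      have h2 := (hasDerivAt_id' y).const_add 1
      refine (((hasDerivAt_id' y).fun_pow 2).fun_sub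
        (((hasDerivAt_id' y).fun_sub (h2.log h1)).const_mul 2)).congr_deriv ?_
      field_simp
      ring
    refine strictMonoOn_of_deriv_pos (convex_Ici 0)
      (fun y hy => (hd y hy).continuousAt.continuousWithinAt) fun y hy => ?_
    rw [interior_Ici, mem_Ioi] at hy
    rw [(hd y hy.le).deriv]
    positivity
  have := hanti self_mem_Ici (mem_Ici.2 hx.le) hx
  simp only [add_zero, Real.log_one, sub_zero, mul_zero] at this
  rw [saddle]
  refine Real.sqrt_le_iff.2 ⟨hx.le, ?_⟩
  linarith

/-- With `t = saddle x`, the derivative has the sign of `x²/((1+x)t) - t`, negative by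
`sq_div_lt_saddle_sq`. -/
lemma strictAntiOn_saddle_div : StrictAntiOn (fun x => saddle x / x) (Ioi 0) := by
  have hd (x : ℝ) (hx : 0 < x) : HasDerivAt (fun x => saddle x / x)
      ((x / ((1 + x) * saddle x) * x - saddle x * 1) / x ^ 2) x :=
    (hasDerivAt_saddle hx).div (hasDerivAt_id x) hx.ne'
  refine strictAntiOn_of_deriv_neg (convex_Ioi 0)
    (fun y hy => (hd y hy).continuousAt.continuousWithinAt) fun x hx => ?_
  rw [interior_Ioi, mem_Ioi] at hx
  rw [(hd x hx).deriv]
  refine div_neg_of_neg_of_pos ?_ (by positivity)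
  have h1 := sq_div_lt_saddle_sq hx
  rw [← saddle_sq hx] at h1
  have h2 := saddle_pos hx
  rw [div_mul_eq_mul_div, sub_neg, div_lt_iff₀ (by positivity)]
  rw [div_lt_iff₀ (by positivity)] at h1
  nlinarith

/-- The inverse of `saddle` on the positive half-line. -/
noncomputable def saddleInv : ℝ → ℝ := Function.invFunOn saddle (Ioi 0)

lemma saddleInv_pos {t : ℝ} (ht : 0 < t) : 0 < saddleInv t := by
  have : t ∈ saddle '' Ioi 0 := by rw [image_saddle]; exact ht
  exact Function.invFunOn_mem this

lemma saddle_saddleInv {t : ℝ} (ht : 0 < t) : saddle (saddleInv t) = t := by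
  have : t ∈ saddle '' Ioi 0 := by rw [image_saddle]; exact ht
  exact Function.invFunOn_eq this

lemma saddleInv_saddle {x : ℝ} (hx : 0 < x) : saddleInv (saddle x) = x :=
  strictMonoOn_saddle.injOn (saddleInv_pos (saddle_pos hx)).le hx.le
    (saddle_saddleInv (saddle_pos hx))

lemma strictMonoOn_saddleInv : StrictMonoOn saddleInv (Ioi 0) := by
  intro a ha b hb hab
  rw [← saddle_saddleInv ha, ← saddle_saddleInv hb] at hab
  exact (strictMonoOn_saddle.lt_iff_lt (saddleInv_pos ha).le (saddleInv_pos hb).le).1 hab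

/-- The Jacobian factor `t / x` of the substitution `t = saddle x`. -/
noncomputable def saddleRatio (t : ℝ) : ℝ := t / saddleInv t

lemma strictAntiOn_saddleRatio : StrictAntiOn saddleRatio (Ioi 0) := by
  intro a ha b hb hab
  have := strictAntiOn_saddle_div (saddleInv_pos ha) (saddleInv_pos hb)
    (strictMonoOn_saddleInv ha hb hab)
  simpa only [saddleRatio, saddle_saddleInv ha, saddle_saddleInv hb] using this

lemma saddleRatio_pos {t : ℝ} (ht : 0 < t) : 0 < saddleRatio t := div_pos ht (saddleInv_pos ht)

lemma saddleRatio_le_one {t : ℝ} (ht : 0 < t) : saddleRatio t ≤ 1 := by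
  have := saddle_le (saddleInv_pos ht)
  rw [saddle_saddleInv ht] at this
  exact (div_le_one (saddleInv_pos ht)).2 this

lemma one_sub_le_saddleRatio {t : ℝ} (ht : 0 < t) : 1 - t ≤ saddleRatio t := by
  have hx := saddleInv_pos ht
  have h := sq_div_lt_saddle_sq hx
  rw [← saddle_sq hx, saddle_saddleInv ht, div_lt_iff₀ (by positivity)] at h
  rw [saddleRatio, le_div_iff₀ hx]
  set x := saddleInv t
  -- The goal amounts to `x ≤ t(1+x)`, which is weaker than `x² < t²(1+x)`.
  by_contra! hc
  have h3 : t * (1 + x) < x := by linarith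
  have h4 : t < x := by nlinarith
  nlinarith

lemma saddleRatio_saddle {x : ℝ} (hx : 0 < x) : saddleRatio (saddle x) = saddle x / x := by
  rw [saddleRatio, saddleInv_saddle hx]

/-! ### Gaussian integrals of the Jacobian factor -/

lemma integral_gaussian_saddleRatio_eq (n : ℕ) (hn : n ≠ 0) :
    ∫ t in Ioi (0 : ℝ), Real.exp (-(n / 2) * t ^ 2) * saddleRatio t =
      ∫ x in Ioi (0 : ℝ), (1 + x) ^ (n - 1) * Real.exp (-(n * x)) := by
  have h := integral_image_eq_integral_abs_deriv_smul measurableSet_Ioi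
    (fun x (hx : x ∈ Ioi (0 : ℝ)) => (hasDerivAt_saddle hx).hasDerivWithinAt)
    (strictMonoOn_saddle.injOn.mono Ioi_subset_Ici_self)
    (fun t => Real.exp (-(n / 2) * t ^ 2) * saddleRatio t)
  rw [image_saddle] at h
  rw [h]
  refine setIntegral_congr_fun measurableSet_Ioi fun x (hx : 0 < x) => ?_
  have hs := saddle_pos hx
  simp only [smul_eq_mul]
  rw [abs_of_pos (by positivity), saddleRatio_saddle hx, saddle_sq hx,
    show -((n : ℝ) / 2) * (2 * (x - Real.log (1 + x))) = n * Real.log (1 + x) + -(n * x) by ring,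
    Real.exp_add, mul_comm (n : ℝ) (Real.log _), ← Real.rpow_def_of_pos (by positivity),
    Real.rpow_natCast]
  obtain ⟨k, rfl⟩ := Nat.exists_eq_succ_of_ne_zero hn
  rw [Nat.succ_sub_one, pow_succ]
  field_simp

/-- After rescaling, the Gaussian weight no longer involves `c`, so monotonicity in `c` comes from
`saddleRatio` alone. -/
lemma integral_gaussian_saddleRatio_rescale {c : ℝ} (hc : 0 < c) :
    c * ∫ t in Ioi (0 : ℝ), Real.exp (-(c ^ 2 / 2) * t ^ 2) * saddleRatio t =
      ∫ s in Ioi (0 : ℝ), Real.exp (-(1 / 2) * s ^ 2) * saddleRatio (s / c) := by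
  have := integral_comp_mul_left_Ioi
    (fun s => Real.exp (-(1 / 2) * s ^ 2) * saddleRatio (s / c)) 0 hc
  rw [mul_zero, smul_eq_mul, eq_inv_mul_iff_mul_eq₀ hc.ne'] at this
  rw [← this]
  congr 2
  ext t
  rw [mul_div_cancel_left₀ _ hc.ne']
  congr 2
  ring

lemma integrableOn_pow_mul_exp_neg {c : ℝ} (hc : 0 < c) (k : ℕ) :
    IntegrableOn (fun x : ℝ => x ^ k * Real.exp (-(c * x))) (Ioi 0) := by
  have := integrableOn_rpow_mul_exp_neg_mul_rpow (p := 1) (s := k) (b := c)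
    (by have : (0 : ℝ) ≤ k := k.cast_nonneg
        linarith) one_pos hc
  refine this.congr_fun (fun x _ => ?_) measurableSet_Ioi
  simp

lemma integral_pow_mul_exp_neg {c : ℝ} (hc : 0 < c) (k : ℕ) :
    ∫ x in Ioi (0 : ℝ), x ^ k * Real.exp (-(c * x)) = k.factorial / c ^ (k + 1) := by
  have := Real.integral_rpow_mul_exp_neg_mul_Ioi (a := k + 1) (by positivity) hc
  rw [Real.Gamma_nat_eq_factorial, add_sub_cancel_right] at this
  simp only [Real.rpow_natCast] at this
  rw [this, ← Nat.cast_add_one, Real.rpow_natCast, one_div, inv_pow]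
  field_simp

lemma integrableOn_gaussian_saddleRatio {c : ℝ} (hc : 0 < c) :
    IntegrableOn (fun s => Real.exp (-(1 / 2) * s ^ 2) * saddleRatio (s / c)) (Ioi 0) := by
  have hg : IntegrableOn (fun s : ℝ => Real.exp (-(1 / 2) * s ^ 2)) (Ioi 0) :=
    (integrable_exp_neg_mul_sq (by norm_num)).integrableOn
  refine Integrable.mono' hg (hg.aestronglyMeasurable.mul ?_) ?_
  -- `saddleInv` has no explicit formula; measurability comes from monotonicity.
  · have : AntitoneOn (fun s => saddleRatio (s / c)) (Ioi 0) := fun a ha b hb hab =>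
      strictAntiOn_saddleRatio.antitoneOn (div_pos ha hc) (div_pos hb hc)
        (div_le_div_of_nonneg_right hab hc.le)
    exact (aemeasurable_restrict_of_antitoneOn measurableSet_Ioi this).aestronglyMeasurable
  · filter_upwards [ae_restrict_mem measurableSet_Ioi] with s hs
    have h1 := saddleRatio_pos (div_pos hs hc)
    have h2 := saddleRatio_le_one (div_pos hs hc)
    rw [Real.norm_of_nonneg (by positivity)]
    exact mul_le_of_le_one_right (Real.exp_pos _).le h2

/-- The Gaussian mean of `saddleRatio (s / c)` over the half-line. -/
noncomputable def saddleMean (c : ℝ) : ℝ :=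
  ∫ s in Ioi (0 : ℝ), Real.exp (-(1 / 2) * s ^ 2) * saddleRatio (s / c)

lemma saddleMean_lt {c d : ℝ} (hc : 0 < c) (hcd : c < d) : saddleMean c < saddleMean d := by
  have hd := hc.trans hcd
  have hpos (s : ℝ) (hs : s ∈ Ioi (0 : ℝ)) :
      0 < Real.exp (-(1 / 2) * s ^ 2) * saddleRatio (s / d) -
        Real.exp (-(1 / 2) * s ^ 2) * saddleRatio (s / c) := by
    rw [← mul_sub]
    exact mul_pos (Real.exp_pos _) (sub_pos.2 (strictAntiOn_saddleRatio (div_pos hs hd)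
      (div_pos hs hc) (div_lt_div_of_pos_left hs hc hcd)))
  rw [← sub_pos, saddleMean, saddleMean, ← integral_sub
    (integrableOn_gaussian_saddleRatio hd) (integrableOn_gaussian_saddleRatio hc),
    setIntegral_pos_iff_support_of_nonneg_ae]
  · refine lt_of_lt_of_le ?_ (measure_mono
      (subset_inter (fun s hs => Function.mem_support.2 (hpos s hs).ne') subset_rfl))
    simp
  · filter_upwards [ae_restrict_mem measurableSet_Ioi] with s hs using (hpos s hs).le
  · exact (integrableOn_gaussian_saddleRatio hd).sub (integrableOn_gaussian_saddleRatio hc)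

lemma integral_exp_neg_half_sq :
    ∫ s in Ioi (0 : ℝ), Real.exp (-(1 / 2) * s ^ 2) = Real.sqrt (Real.pi / 2) := by
  rw [integral_gaussian_Ioi, show Real.pi / (1 / 2) = Real.pi / 2 * 2 ^ 2 by ring,
    Real.sqrt_mul (by positivity), Real.sqrt_sq (by norm_num)]
  ring

lemma saddleMean_le {c : ℝ} (hc : 0 < c) : saddleMean c ≤ Real.sqrt (Real.pi / 2) := by
  rw [← integral_exp_neg_half_sq]
  refine setIntegral_mono_on (integrableOn_gaussian_saddleRatio hc)
    (integrable_exp_neg_mul_sq (by norm_num)).integrableOn measurableSet_Ioi fun s hs => ?_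
  exact mul_le_of_le_one_right (Real.exp_pos _).le (saddleRatio_le_one (div_pos hs hc))

lemma le_saddleMean {c : ℝ} (hc : 0 < c) :
    Real.sqrt (Real.pi / 2) - (∫ s in Ioi (0 : ℝ), s * Real.exp (-(1 / 2) * s ^ 2)) / c
      ≤ saddleMean c := by
  have h1 : IntegrableOn (fun s : ℝ => Real.exp (-(1 / 2) * s ^ 2)) (Ioi 0) :=
    (integrable_exp_neg_mul_sq (by norm_num)).integrableOn
  have h2 : IntegrableOn (fun s : ℝ => s * Real.exp (-(1 / 2) * s ^ 2)) (Ioi 0) :=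
    (integrable_mul_exp_neg_mul_sq (by norm_num)).integrableOn
  rw [← integral_exp_neg_half_sq, ← integral_div, ← integral_sub h1 (h2.div_const c)]
  refine setIntegral_mono_on (h1.sub (h2.div_const c)) (integrableOn_gaussian_saddleRatio hc)
    measurableSet_Ioi fun s hs => ?_
  have := mul_le_mul_of_nonneg_left (one_sub_le_saddleRatio (div_pos hs hc))
    (Real.exp_pos (-(1 / 2) * s ^ 2)).le
  calc _ = Real.exp (-(1 / 2) * s ^ 2) * (1 - s / c) := by ring
    _ ≤ _ := this

lemma tendsto_saddleMean :
    Filter.Tendsto saddleMean Filter.atTop (nhds (Real.sqrt (Real.pi / 2))) := by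
  have hlow : Filter.Tendsto (fun c : ℝ => Real.sqrt (Real.pi / 2) -
      (∫ s in Ioi (0 : ℝ), s * Real.exp (-(1 / 2) * s ^ 2)) / c) Filter.atTop
      (nhds (Real.sqrt (Real.pi / 2))) := by
    have h : Filter.Tendsto (fun c : ℝ => (∫ s in Ioi (0 : ℝ), s * Real.exp (-(1 / 2) * s ^ 2)) / c)
        Filter.atTop (nhds 0) := Filter.Tendsto.div_atTop tendsto_const_nhds Filter.tendsto_id
    simpa only [sub_zero] using h.const_sub (Real.sqrt (Real.pi / 2))
  refine tendsto_of_tendsto_of_tendsto_of_le_of_le' hlow tendsto_const_nhds ?_ ?_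
  · filter_upwards [Filter.eventually_gt_atTop 0] with c hc using le_saddleMean hc
  · filter_upwards [Filter.eventually_gt_atTop 0] with c hc using saddleMean_le hc

end BucketTest

/-! ### Integral form of `Q` and behaviour of `μ` -/

namespace BucketTest

open MeasureTheory Set

/-- Expand binomially and use `∫ x^k e^(-nx) dx = k!/n^(k+1)`; then `n · k! · C(n-1, k)` is the
falling factorial of length `k+1`. -/
lemma ramanujanQ_eq_integral {n : ℕ} (hn : n ≠ 0) :
    ramanujanQ n = n * ∫ x in Ioi (0 : ℝ), (1 + x) ^ (n - 1) * Real.exp (-(n * x)) := by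
  obtain ⟨N, rfl⟩ := Nat.exists_eq_succ_of_ne_zero hn
  have hc : (0 : ℝ) < (N.succ : ℕ) := by positivity
  simp only [Nat.succ_sub_one, add_comm (1 : ℝ), add_pow, one_pow, mul_one, Finset.sum_mul]
  rw [integral_finsetSum, Finset.mul_sum, ramanujanQ]
  · refine Finset.sum_congr rfl fun k _ => ?_
    simp only [mul_right_comm _ (Nat.cast _ : ℝ) (Real.exp _)]
    rw [integral_mul_const, integral_pow_mul_exp_neg hc, Nat.succ_eq_add_one,
      Nat.succ_descFactorial_succ, Nat.descFactorial_eq_factorial_mul_choose]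
    push_cast
    ring
  · intro k _
    simp only [mul_right_comm _ (Nat.cast _ : ℝ) (Real.exp _)]
    exact (integrableOn_pow_mul_exp_neg hc k).mul_const _

lemma ramanujanQ_div_sqrt {n : ℕ} (hn : n ≠ 0) :
    ramanujanQ n / Real.sqrt n = saddleMean (Real.sqrt n) := by
  have hs : 0 < Real.sqrt n := Real.sqrt_pos.2 (by positivity)
  have hsq : Real.sqrt n ^ 2 = n := Real.sq_sqrt n.cast_nonneg
  rw [saddleMean, ← integral_gaussian_saddleRatio_rescale hs, hsq,
    integral_gaussian_saddleRatio_eq n hn, ramanujanQ_eq_integral hn, div_eq_iff hs.ne']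
  nth_rewrite 1 [← hsq]
  ring

lemma mu_eq {n : ℕ} (hn : n ≠ 0) :
    mu n = Real.sqrt (Real.pi / 2) - saddleMean (Real.sqrt n) := by
  rw [← ramanujanQ_div_sqrt hn, ← sqrt_pi_div_two_sub_mu hn]
  ring

lemma strictAntiOn_mu : StrictAntiOn mu (Ici 1) := by
  intro a (ha : 1 ≤ a) b (hb : 1 ≤ b) hab
  rw [mu_eq (by omega), mu_eq (by omega)]
  have := saddleMean_lt (Real.sqrt_pos.2 (by exact_mod_cast ha))
    (Real.sqrt_lt_sqrt a.cast_nonneg (Nat.cast_lt.2 hab))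
  linarith

lemma tendsto_mu : Filter.Tendsto mu Filter.atTop (nhds 0) := by
  have h : Filter.Tendsto (fun n : ℕ => Real.sqrt (Real.pi / 2) - saddleMean (Real.sqrt n))
      Filter.atTop (nhds 0) := by
    simpa only [sub_self, Function.comp_def] using ((tendsto_saddleMean.comp
      (Real.tendsto_sqrt_atTop.comp tendsto_natCast_atTop_atTop)).const_sub
        (Real.sqrt (Real.pi / 2)))
  refine h.congr' ?_
  filter_upwards [Filter.eventually_ge_atTop 1] with n hn
  exact (mu_eq (by omega)).symm

end BucketTest

theorem lemma14 :
    (∀ {Ω : Type*} [MeasurableSpace Ω] (P : MeasureTheory.Measure Ω)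
        [MeasureTheory.IsProbabilityMeasure P] (m n : ℕ), 1 ≤ m → n = m ^ 2 →
      ∀ s : Fin n → Ω → ℕ,
        (∀ i, ProbabilityTheory.HasLaw (s i) (ProbabilityTheory.uniformOn (Set.Icc 1 n)) P) →
        ProbabilityTheory.iIndepFun s P →
        ∀ j ∈ Finset.Icc 1 m,
          MeasureTheory.Integrable
            (fun ω => (BucketTest.bucketCount m (fun i => s i ω) j : ℝ)) P ∧
          ∫ ω, (BucketTest.bucketCount m (fun i => s i ω) j : ℝ) ∂P
            = Real.sqrt (Real.pi / 2) - BucketTest.mu n) ∧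
    StrictAntiOn BucketTest.mu (Set.Ici 1) ∧
    Filter.Tendsto BucketTest.mu Filter.atTop (nhds 0) := by
  refine ⟨?_, BucketTest.strictAntiOn_mu, BucketTest.tendsto_mu⟩
  intro Ω _ P _ m n hm hn s hs hi j hj
  obtain ⟨h1, h2⟩ := BucketTest.integrable_integral_bucketCount P hm hn s hs hi hj
  refine ⟨h1, h2.trans ?_⟩
  have hm0 : (m : ℝ) ≠ 0 := by exact_mod_cast (by omega : m ≠ 0)
  have hn0 : n ≠ 0 := by
    have : 0 < m ^ 2 := by positivity
    omega
  have hn' : (n : ℝ) = m ^ 2 := by exact_mod_cast hn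
  -- Since `n = m²`, the factor `m/n` equals `1/√n`.
  rw [BucketTest.sqrt_pi_div_two_sub_mu hn0, hn', Real.sqrt_sq m.cast_nonneg]
  field_simp
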